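/- **Setting.** An *ultragraph* $\mathcal U=(U^0,\mathcal U^1,r,s)$ consists of a vertex set $U^0$, an edge set $\mathcal U^1$ and maps $r,s:\mathcal U^1\to P(U^0)\setminus\{\varnothing\}$ such that every $r(e)$ is a singleton. It is assumed to be regular: $0<|\{e\in\mathcal U^1: r(e)=\{v\}\}|<\infty$ for all $v\in U^0$. Let $\mathcal U^0$ be the smallest collection of subsets of $U^0$ which contains $\varnothing$, all $\{v\}$ ($v\in U^0$) and all $s(e)$ ($e\in\mathcal U^1$) and is closed under finite intersections, finite unions and differences. The set $\mathcal U^*$ of finite paths consists of the paths of length zero, which are the $A\in\mathcal U^0$, with $s(A)=A$, and of the words $\alpha=e_1\cdots e_n$ ($n\ge 1$) of edges with $r(e_{i+1})\subseteq s(e_i)$, with $s(\alpha)=s(e_n)$. A *Cuntz–Krieger $\mathcal U$-family* in a $C^*$-algebra consists of partial isometries $s_e$ ($e\in\mathcal U^1$) with mutually orthogonal ranges and projections $p_A$ ($A\in\mathcal U^0$) such that $p_\varnothing=0$, $p_Ap_B=p_{A\cap B}$, $p_{A\cup B}=p_A+p_B-p_{A\cap B}$, $s_e^*s_e=p_{s(e)}$,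 $s_es_e^*\le p_{r(e)}$ and $p_{\{v\}}=\sum_{r(e)=\{v\}}s_es_e^*$ for all $A,B\in\mathcal U^0$, $e\in\mathcal U^1$, $v\in U^0$. A *self-similar ultragraph* $(G,\mathcal U,\varphi)$ consists of a discrete group $G$ acting on $U^0$ and on $\mathcal U^1$ with $r(g\cdot e)=g\cdot r(e)$ and $s(g\cdot e)=g\cdot s(e)$, and a map $\varphi:G\times\mathcal U^1\to G$ with $\varphi(gh,e)=\varphi(g,h\cdot e)\varphi(h,e)$ and $\varphi(g,e)\cdot s(e)\subseteq g\cdot s(e)$ for all $g,h\in G$, $e\in\mathcal U^1$. Here $g\cdot A=\{g\cdot v:v\in A\}$ for a set $A$ of vertices. The $C^*$-algebra $\mathcal O_{G,\mathcal U}$ is the universal $C^*$-algebra generated by a Cuntz–Krieger $\mathcal U$-family $\{s_e,p_A\}$ and elements $u_{A,g}$ ($A\in\mathcal U^0$, $g\in G$) such that $u_{A,1_G}=p_A$, $u_{A,g}^*=u_{g^{-1}\cdot A,\,g^{-1}}$, $u_{A,g}u_{B,h}=u_{A\cap(g\cdot B),\,gh}$, and $u_{A,g}s_e=s_{g\cdot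 e}\,u_{g\cdot s(e),\,\varphi(g,e)}$ if $g\cdot r(e)\subseteq A$, while $u_{A,g}s_e=0$ otherwise. Let $\mathcal D_{G,\mathcal U}$ be the universal unital $C^*$-algebra generated by a Cuntz–Krieger $\mathcal U$-family $\{s_e,p_A\}$ and a unitary representation $g\mapsto u_g$ of $G$ such that $u_gp_A=p_{g\cdot A}u_g$ and $u_gs_e=s_{g\cdot e}u_{\varphi(g,e)}$ for all $g\in G$, $A\in\mathcal U^0$, $e\in\mathcal U^1$. For a finite path put $s_\alpha=p_A$ if $\alpha=A\in\mathcal U^0$ and $s_\alpha=s_{e_1}\cdots s_{e_n}$ if $\alpha=e_1\cdots e_n$, and define $$\widetilde{\mathcal O}_{G,\mathcal U}:=\overline{\mathrm{span}}\{s_\alpha p_Au_gs_\beta^*:\ \alpha,\beta\in\mathcal U^*,\ A\in\mathcal U^0,\ g\in G,\ A\subseteq s(\alpha)\cap g\cdot s(\beta)\}\subseteq\mathcal D_{G,\mathcal U}.$$ **Statement.** For every self-similar ultragraph $(G,\mathcal U,\varphi)$ with $\mathcal U$ regular, $\widetilde{\mathcal O}_{G,\mathcal U}$ is a $C^*$-subalgebra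 of $\mathcal D_{G,\mathcal U}$, and it is $*$-isomorphic to $\mathcal O_{G,\mathcal U}$. -/

import Mathlib

open scoped ENNReal Pointwise

/-! ### Universal C*-algebras given by generators and relations -/

/-- Noncommutative `*`-polynomials without constant term, as formal expressions in the letters of
`X`. -/
inductive StarPoly (X : Type*) where
  | gen : X → StarPoly X
  | zero : StarPoly X
  | add : StarPoly X → StarPoly X → StarPoly X
  | mul : StarPoly X → StarPoly X → StarPoly X
  | smul : ℂ → StarPoly X → StarPoly X
  | adj : StarPoly X → StarPoly X

/-- The value of a `*`-polynomial at a family of elements of a C*-algebra. -/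
def StarPoly.eval {X A : Type*} [NonUnitalCStarAlgebra A] (f : X → A) : StarPoly X → A
  | gen x => f x
  | zero => 0
  | add a b => a.eval f + b.eval f
  | mul a b => a.eval f * b.eval f
  | smul c a => c • a.eval f
  | adj a => star (a.eval f)

/-- A system of relations on the letters of `X` which admits a universal C*-algebra: the relations
bound the norms of the generators, and they can be tested on any jointly faithful collection of
`*`-homomorphisms. -/
structure CStarRelations.{w} (X : Type w) where
  Holds : ∀ (A : Type w) [NonUnitalCStarAlgebra A], (X → A) → Prop
  bounded : ∀ x, ∃ C : ℝ, ∀ (A : Type w) [NonUnitalCStarAlgebra A] (f : X → A),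
    Holds A f → ‖f x‖ ≤ C
  reflects : ∀ (A : Type w) [NonUnitalCStarAlgebra A] (f : X → A) (I : Type w) (B : I → Type w)
    [∀ i, NonUnitalCStarAlgebra (B i)] (π : ∀ i, A →⋆ₙₐ[ℂ] B i),
    (∀ a, (∀ i, π i a = 0) → a = 0) → (∀ i, Holds (B i) (fun x => π i (f x))) → Holds A f

namespace CStarRelations

universe w

/-- A representation of the relations: a C*-algebra with a family satisfying them. -/
structure Rep {X : Type w} (R : CStarRelations X) where
  carrier : Type w
  [inst : NonUnitalCStarAlgebra carrier]
  fam : X → carrier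
  holds : R.Holds carrier fam

attribute [instance] Rep.inst

variable {X : Type w} (R : CStarRelations X)

/-- The C*-seminorm on `*`-polynomials induced by a representation. -/
def Rep.seminorm {R : CStarRelations X} (ρ : Rep R) : StarPoly X → ℝ :=
  fun a => ‖a.eval ρ.fam‖

/-- The (small) set of all C*-seminorms induced by representations. -/
abbrev Index : Type w := Set.range (Rep.seminorm (R := R))

/-- A representation inducing the given seminorm. -/
noncomputable def rep (i : R.Index) : Rep R := i.2.choose

theorem rep_seminorm (i : R.Index) : (R.rep i).seminorm = i.1 := i.2.choose_spec

/-- The C*-algebra of bounded families in the product of these representations. -/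
abbrev Ambient : Type w := lp (fun i : R.Index => (R.rep i).carrier) ∞

/-- The universal family, inside the product of representations. -/
noncomputable def ambientGen (x : X) : R.Ambient :=
  ⟨fun i => (R.rep i).fam x, memℓp_infty (by
    obtain ⟨C, hC⟩ := R.bounded x
    refine ⟨C, ?_⟩
    rintro _ ⟨i, rfl⟩
    exact hC _ _ (R.rep i).holds)⟩

/-- The C*-subalgebra generated by the universal family. -/
noncomputable def subalg : NonUnitalStarSubalgebra ℂ R.Ambient :=
  (NonUnitalStarAlgebra.adjoin ℂ (Set.range R.ambientGen)).topologicalClosure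

/-- The universal C*-algebra of the relations `R`. -/
def Alg : Type w := R.subalg

noncomputable instance : NonUnitalCStarAlgebra R.Alg :=
  NonUnitalStarSubalgebra.nonUnitalCStarAlgebra R.subalg
    (h_closed := NonUnitalStarSubalgebra.isClosed_topologicalClosure _)

/-- The generators of the universal C*-algebra. -/
noncomputable def gen (x : X) : R.Alg :=
  ⟨R.ambientGen x, NonUnitalStarSubalgebra.le_topologicalClosure _
    (NonUnitalStarAlgebra.subset_adjoin ℂ _ ⟨x, rfl⟩)⟩

/-- The coordinate homomorphisms of the universal C*-algebra. -/
noncomputable def proj (i : R.Index) : R.Alg →⋆ₙₐ[ℂ] (R.rep i).carrier where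
  toFun a := (a.1 : R.Ambient) i
  map_smul' _ _ := rfl
  map_zero' := rfl
  map_add' _ _ := rfl
  map_mul' _ _ := rfl
  map_star' _ := rfl

/-- The generators of the universal C*-algebra satisfy the relations. -/
theorem holds_gen : R.Holds R.Alg R.gen := by
  refine R.reflects R.Alg R.gen R.Index (fun i => (R.rep i).carrier) R.proj ?_ ?_
  · intro a ha
    apply Subtype.ext
    apply lp.ext
    funext i
    exact ha i
  · intro i
    exact (R.rep i).holds

theorem eval_map {A B : Type*} [NonUnitalCStarAlgebra A] [NonUnitalCStarAlgebra B]
    (φ : A →⋆ₙₐ[ℂ] B) (f : X → A) (a : StarPoly X) :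
    φ (a.eval f) = a.eval (fun x => φ (f x)) := by
  induction a with
  | gen x => rfl
  | zero => exact map_zero φ
  | add a b ha hb => simp only [StarPoly.eval, map_add, ha, hb]
  | mul a b ha hb => simp only [StarPoly.eval, map_mul, ha, hb]
  | smul c a ha => simp only [StarPoly.eval, map_smul, ha]
  | adj a ha => simp only [StarPoly.eval, map_star, ha]

/-- The universal C*-algebra is the closure of the `*`-polynomials in its generators. -/
theorem dense_eval : DenseRange (fun a : StarPoly X => a.eval R.gen) := by
  have key : ∀ y : R.Ambient, y ∈ NonUnitalStarAlgebra.adjoin ℂ (Set.range R.ambientGen) →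
      ∃ a : StarPoly X, ((a.eval R.gen).1 : R.Ambient) = y := by
    intro y hy
    induction hy using NonUnitalStarAlgebra.adjoin_induction with
    | mem y hy => obtain ⟨x, rfl⟩ := hy; exact ⟨.gen x, rfl⟩
    | add y z _ _ hy hz =>
      obtain ⟨a, rfl⟩ := hy; obtain ⟨b, rfl⟩ := hz; exact ⟨.add a b, rfl⟩
    | zero => exact ⟨.zero, rfl⟩
    | mul y z _ _ hy hz =>
      obtain ⟨a, rfl⟩ := hy; obtain ⟨b, rfl⟩ := hz; exact ⟨.mul a b, rfl⟩
    | smul c y _ hy => obtain ⟨a, rfl⟩ := hy; exact ⟨.smul c a, rfl⟩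
    | star y _ hy => obtain ⟨a, rfl⟩ := hy; exact ⟨.adj a, rfl⟩
  intro y
  rw [Metric.mem_closure_iff]
  intro ε hε
  have hy : (y.1 : R.Ambient) ∈
      closure (NonUnitalStarAlgebra.adjoin ℂ (Set.range R.ambientGen) : Set R.Ambient) := y.2
  obtain ⟨z, hz, hyz⟩ := Metric.mem_closure_iff.1 hy ε hε
  obtain ⟨a, rfl⟩ := key z hz
  exact ⟨_, ⟨a, rfl⟩, hyz⟩

theorem norm_eval_le {B : Type w} [NonUnitalCStarAlgebra B] {f : X → B} (hf : R.Holds B f)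
    (a : StarPoly X) : ‖a.eval f‖ ≤ ‖a.eval R.gen‖ := by
  let i : R.Index := ⟨(Rep.mk B f hf).seminorm, ⟨_, rfl⟩⟩
  have h1 : ‖a.eval (R.rep i).fam‖ = ‖a.eval f‖ := congrFun (R.rep_seminorm i) a
  have h2 : R.proj i (a.eval R.gen) = a.eval (R.rep i).fam := eval_map (R.proj i) R.gen a
  have h3 : ‖R.proj i (a.eval R.gen)‖ ≤ ‖a.eval R.gen‖ :=
    lp.norm_apply_le_norm (p := ∞) (by simp) (a.eval R.gen).1 i
  rw [← h1, ← h2]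
  exact h3

/-- Two `*`-homomorphisms which agree on the generators are equal. -/
theorem hom_ext {B : Type*} [NonUnitalCStarAlgebra B] {φ ψ : R.Alg →⋆ₙₐ[ℂ] B}
    (h : ∀ x, φ (R.gen x) = ψ (R.gen x)) : φ = ψ := by
  have hc : ∀ χ : R.Alg →⋆ₙₐ[ℂ] B, Continuous χ := fun χ =>
    AddMonoidHomClass.continuous_of_bound χ 1 fun a => by
      simpa only [one_mul] using NonUnitalStarAlgHom.norm_apply_le χ a
  refine DFunLike.coe_injective (R.dense_eval.equalizer (hc φ) (hc ψ) ?_)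
  funext a
  simp only [Function.comp_apply, eval_map, h]

/-- The universal property. -/
theorem exists_lift {B : Type w} [NonUnitalCStarAlgebra B] {f : X → B} (hf : R.Holds B f) :
    ∃ φ : R.Alg →⋆ₙₐ[ℂ] B, ∀ x, φ (R.gen x) = f x := by
  have hsub : ∀ a b : StarPoly X, ‖a.eval f - b.eval f‖ ≤ ‖a.eval R.gen - b.eval R.gen‖ := by
    intro a b
    have h := R.norm_eval_le hf (.add a (.smul (-1) b))
    simpa [StarPoly.eval, sub_eq_add_neg] using h
  let P : Set R.Alg := Set.range (fun a : StarPoly X => a.eval R.gen)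
  let g : P → B := fun y => (y.2.choose).eval f
  have hg : ∀ a : StarPoly X, g ⟨a.eval R.gen, ⟨a, rfl⟩⟩ = a.eval f := by
    intro a
    have hs := (⟨a, rfl⟩ : a.eval R.gen ∈ P).choose_spec
    have h := hsub (⟨a, rfl⟩ : a.eval R.gen ∈ P).choose a
    simp only [hs, sub_self, norm_zero] at h
    exact sub_eq_zero.1 (norm_le_zero_iff.1 h)
  have hlip : LipschitzWith 1 g := by
    refine LipschitzWith.of_dist_le_mul ?_
    rintro ⟨_, a, rfl⟩ ⟨_, b, rfl⟩
    rw [hg, hg, dist_eq_norm, NNReal.coe_one, one_mul]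
    exact (hsub a b).trans_eq (dist_eq_norm (a.eval R.gen) (b.eval R.gen)).symm
  have hP : Dense P := R.dense_eval
  have hui : IsUniformInducing ((↑) : P → R.Alg) := isUniformEmbedding_subtype_val.isUniformInducing
  have hdr : DenseRange ((↑) : P → R.Alg) := hP.denseRange_val
  let F : R.Alg → B := (hui.isDenseInducing hdr).extend g
  have hFc : Continuous F := (uniformContinuous_uniformly_extend hui hdr
    hlip.uniformContinuous).continuous
  have hF : ∀ a : StarPoly X, F (a.eval R.gen) = a.eval f := by
    intro a
    rw [← hg a]
    exact uniformly_extend_of_ind hui hdr hlip.uniformContinuous ⟨a.eval R.gen, ⟨a, rfl⟩⟩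
  refine ⟨{ toFun := F, map_smul' := ?_, map_zero' := hF .zero, map_add' := ?_, map_mul' := ?_,
            map_star' := ?_ }, fun x => hF (.gen x)⟩
  · intro c y
    refine R.dense_eval.induction_on (p := fun y => F (c • y) = c • F y) y ?_ ?_
    · exact isClosed_eq (hFc.comp (continuous_const_smul c)) (hFc.const_smul c)
    · intro a; rw [hF]; exact hF (.smul c a)
  · intro y z
    refine R.dense_eval.induction_on₂ (p := fun y z => F (y + z) = F y + F z) ?_ ?_ y z
    · exact isClosed_eq (hFc.comp continuous_add)
        ((hFc.comp continuous_fst).add (hFc.comp continuous_snd))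
    · intro a b; rw [hF, hF]; exact hF (.add a b)
  · intro y z
    refine R.dense_eval.induction_on₂ (p := fun y z => F (y * z) = F y * F z) ?_ ?_ y z
    · exact isClosed_eq (hFc.comp continuous_mul)
        ((hFc.comp continuous_fst).mul (hFc.comp continuous_snd))
    · intro a b; rw [hF, hF]; exact hF (.mul a b)
  · intro y
    refine R.dense_eval.induction_on (p := fun y => F (star y) = star (F y)) y ?_ ?_
    · exact isClosed_eq (hFc.comp continuous_star) hFc.star
    · intro a; rw [hF]; exact hF (.adj a)

end CStarRelations

/-! ### Ultragraphs and self-similar ultragraphs -/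

/-- An ultragraph with vertex set `V` and edge set `E`. The range of an edge `e` is the singleton
`{r e}`, and its source is a nonempty set of vertices. -/
structure Ultragraph (V E : Type*) where
  r : E → V
  s : E → Set V
  s_nonempty : ∀ e, (s e).Nonempty

namespace Ultragraph

variable {V E : Type*} (U : Ultragraph V E)

/-- Every vertex receives at least one and only finitely many edges. -/
def IsRegular : Prop := ∀ v, {e | U.r e = v}.Nonempty ∧ {e | U.r e = v}.Finite

/-- Membership in the smallest collection of sets of vertices which contains the empty set, the
singletons and the sources of edges, and is closed under finite intersections, unions and
differences. -/
inductive IsVSet : Set V → Prop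
  | empty : IsVSet ∅
  | singleton (v : V) : IsVSet {v}
  | source (e : E) : IsVSet (U.s e)
  | inter {A B : Set V} : IsVSet A → IsVSet B → IsVSet (A ∩ B)
  | union {A B : Set V} : IsVSet A → IsVSet B → IsVSet (A ∪ B)
  | diff {A B : Set V} : IsVSet A → IsVSet B → IsVSet (A \ B)

/-- The generalized vertices of `U`, that is, the members of the collection above. -/
@[ext]
structure VSet where
  val : Set V
  isVSet : U.IsVSet val

namespace VSet

variable {U}

instance : EmptyCollection U.VSet := ⟨⟨∅, .empty⟩⟩
instance : Inter U.VSet := ⟨fun A B => ⟨A.val ∩ B.val, .inter A.isVSet B.isVSet⟩⟩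
instance : Union U.VSet := ⟨fun A B => ⟨A.val ∪ B.val, .union A.isVSet B.isVSet⟩⟩
instance : Singleton V U.VSet := ⟨fun v => ⟨{v}, .singleton v⟩⟩

end VSet

/-- The source of an edge as a generalized vertex. -/
def src (e : E) : U.VSet := ⟨U.s e, .source e⟩

/-- Finite paths: a path of length zero is a generalized vertex, a path of positive length is a
nonempty word `e₁ ⋯ eₙ` of edges with `r(eᵢ₊₁) ⊆ s(eᵢ)`. -/
inductive FinPath
  | vertex (A : U.VSet)
  | edges (l : List E) (ne : l ≠ []) (chain : l.IsChain fun e f => U.r f ∈ U.s e)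

/-- The source of a finite path; `s(A) = A` and `s(e₁ ⋯ eₙ) = s(eₙ)`. -/
def FinPath.source {U : Ultragraph V E} : U.FinPath → Set V
  | .vertex A => A.val
  | .edges l ne _ => U.s (l.getLast ne)

/-- The element `s_α`: it is `p_A` if `α = A` has length zero and `s_{e₁} ⋯ s_{eₙ}` if
`α = e₁ ⋯ eₙ`. -/
def FinPath.elem {U : Ultragraph V E} {D : Type*} [Monoid D] (S : E → D) (P : U.VSet → D) :
    U.FinPath → D
  | .vertex A => P A
  | .edges l _ _ => (l.map S).prod

/-- Cuntz-Krieger families. The relation `S e * star (S e) ≤ P {r e}` between projections is written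
as `P {r e} * (S e * star (S e)) = S e * star (S e)`. The last relation is imposed at the vertices
which receive at least one and only finitely many edges; in a regular ultragraph these are all
vertices. -/
structure IsCuntzKriegerFamily {A : Type*} [NonUnitalCStarAlgebra A]
    (S : E → A) (P : U.VSet → A) : Prop where
  partial_isometry : ∀ e, S e * star (S e) * S e = S e
  orthogonal_ranges : ∀ e f, e ≠ f → (S e * star (S e)) * (S f * star (S f)) = 0
  projection : ∀ B, IsStarProjection (P B)
  map_empty : P ∅ = 0
  map_inter : ∀ B C, P B * P C = P (B ∩ C)
  map_union : ∀ B C, P (B ∪ C) = P B + P C - P (B ∩ C)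
  source_proj : ∀ e, star (S e) * S e = P (U.src e)
  range_le : ∀ e, P {U.r e} * (S e * star (S e)) = S e * star (S e)
  vertex_sum : ∀ (v : V) (h : {e | U.r e = v}.Finite), {e | U.r e = v}.Nonempty →
    P {v} = ∑ e ∈ h.toFinset, S e * star (S e)

end Ultragraph

/-- A self-similar ultragraph: an ultragraph with an action of the group `G` by automorphisms
and a 1-cocycle `φ : G × E → G` such that `φ(g, e) • s(e) ⊆ g • s(e)`. -/
structure SelfSimilarUltragraph (G V E : Type*) [Group G] [MulAction G V] [MulAction G E]
    extends Ultragraph V E where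
  r_smul : ∀ (g : G) (e : E), r (g • e) = g • r e
  s_smul : ∀ (g : G) (e : E), s (g • e) = g • s e
  φ : G → E → G
  cocycle : ∀ (g h : G) (e : E), φ (g * h) e = φ g (h • e) * φ h e
  cocycle_source : ∀ (g : G) (e : E), φ g e • s e ⊆ g • s e

namespace SelfSimilarUltragraph

variable {G V E : Type*} [Group G] [MulAction G V] [MulAction G E]
  (U : SelfSimilarUltragraph G V E)

/-- The collection of generalized vertices of a self-similar ultragraph. -/
abbrev VSet := U.toUltragraph.VSet

theorem isVSet_smul (g : G) {A : Set V} (hA : U.IsVSet A) : U.IsVSet (g • A) := by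
  induction hA with
  | empty => simpa using Ultragraph.IsVSet.empty
  | singleton v => simpa using Ultragraph.IsVSet.singleton (g • v)
  | source e => simpa only [U.s_smul] using Ultragraph.IsVSet.source (U := U.toUltragraph) (g • e)
  | inter _ _ hA hB => rw [Set.smul_set_inter]; exact .inter hA hB
  | union _ _ hA hB => rw [Set.smul_set_union]; exact .union hA hB
  | diff _ _ hA hB => rw [Set.smul_set_sdiff]; exact .diff hA hB

/-- The action of `G` on generalized vertices, `g • A = {g • v | v ∈ A}`. -/
instance : SMul G U.VSet := ⟨fun g A => ⟨g • A.val, U.isVSet_smul g A.isVSet⟩⟩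

/-- `(G, U)`-families in a C*-algebra. -/
structure IsFamily {A : Type*} [NonUnitalCStarAlgebra A]
    (S : E → A) (P : U.VSet → A) (u : U.VSet → G → A) : Prop where
  cuntzKrieger : U.IsCuntzKriegerFamily S P
  u_one : ∀ B, u B 1 = P B
  u_star : ∀ B g, star (u B g) = u (g⁻¹ • B) g⁻¹
  u_mul : ∀ B C g h, u B g * u C h = u (B ∩ g • C) (g * h)
  u_edge : ∀ B g e, g • U.r e ∈ B.val → u B g * S e = S (g • e) * u (g • U.src e) (U.φ g e)
  u_edge_zero : ∀ B g e, g • U.r e ∉ B.val → u B g * S e = 0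

/-- Families in a unital C*-algebra which consist of a Cuntz-Krieger family and a unitary
representation of `G`, subject to the covariance relations. -/
structure IsUnitaryFamily {D : Type*} [CStarAlgebra D]
    (S : E → D) (P : U.VSet → D) (u : G → D) : Prop where
  cuntzKrieger : U.IsCuntzKriegerFamily S P
  u_unitary : ∀ g, u g ∈ unitary D
  u_one : u 1 = 1
  u_mul : ∀ g h, u (g * h) = u g * u h
  u_proj : ∀ g B, u g * P B = P (g • B) * u g
  u_edge : ∀ g e, u g * S e = S (g • e) * u (U.φ g e)

end SelfSimilarUltragraph

section Auxiliary

theorem norm_le_one_of_isStarProjection {A : Type*} [NonUnitalCStarAlgebra A] {p : A}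
    (hp : IsStarProjection p) : ‖p‖ ≤ 1 := by
  have h := CStarRing.norm_star_mul_self (x := p)
  rw [hp.isSelfAdjoint.star_eq, hp.isIdempotentElem.eq] at h
  nlinarith [norm_nonneg p]

theorem norm_le_one_of_star_mul_self {A : Type*} [NonUnitalCStarAlgebra A] {a p : A}
    (hp : IsStarProjection p) (h : star a * a = p) : ‖a‖ ≤ 1 := by
  have h1 := CStarRing.norm_star_mul_self (x := a)
  have h2 := norm_le_one_of_isStarProjection hp
  rw [h] at h1
  nlinarith [norm_nonneg a]

/-- The relations of a Cuntz-Krieger family can be tested on jointly faithful collections of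
`*`-homomorphisms. -/
theorem Ultragraph.IsCuntzKriegerFamily.of_comp {V E : Type*} {U : Ultragraph V E} {A : Type*}
    [NonUnitalCStarAlgebra A] {S : E → A} {P : U.VSet → A} {I : Type*} {B : I → Type*}
    [∀ i, NonUnitalCStarAlgebra (B i)] (π : ∀ i, A →⋆ₙₐ[ℂ] B i)
    (hπ : ∀ a b, (∀ i, π i a = π i b) → a = b)
    (h : ∀ i, U.IsCuntzKriegerFamily (fun e => π i (S e)) (fun C => π i (P C))) :
    U.IsCuntzKriegerFamily S P where
  partial_isometry e := hπ _ _ fun i => by simpa [map_star] using (h i).partial_isometry e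
  orthogonal_ranges e f hef := hπ _ _ fun i => by simpa [map_star] using (h i).orthogonal_ranges e f hef
  projection C :=
    ⟨hπ _ _ fun i => by simpa [map_star] using ((h i).projection C).isIdempotentElem.eq,
      hπ _ _ fun i => by simpa [map_star] using ((h i).projection C).isSelfAdjoint.star_eq⟩
  map_empty := hπ _ _ fun i => by simpa [map_star] using (h i).map_empty
  map_inter C D := hπ _ _ fun i => by simpa [map_star] using (h i).map_inter C D
  map_union C D := hπ _ _ fun i => by simpa [map_star] using (h i).map_union C D
  source_proj e := hπ _ _ fun i => by simpa [map_star] using (h i).source_proj e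
  range_le e := hπ _ _ fun i => by simpa [map_star] using (h i).range_le e
  vertex_sum v hf hne := hπ _ _ fun i => by simpa [map_star] using (h i).vertex_sum v hf hne

end Auxiliary

namespace SelfSimilarUltragraph

universe u₁ u₂ u₃

variable {G : Type u₁} {V : Type u₂} {E : Type u₃} [Group G] [MulAction G V] [MulAction G E]
  (U : SelfSimilarUltragraph G V E)

/-! ### The C*-algebra of a self-similar ultragraph -/

/-- The letters `s_e`, `p_A` and `u_{A,g}`. -/
inductive Letter : Type (max u₁ u₂ u₃)
  | s (e : E)
  | p (A : U.VSet)
  | u (A : U.VSet) (g : G)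

/-- The defining relations of a `(G, U)`-family. -/
def relations : CStarRelations U.Letter where
  Holds _ _ f := U.IsFamily (fun e => f (.s e)) (fun B => f (.p B)) (fun B g => f (.u B g))
  bounded x := by
    refine ⟨1, fun A _ f hf => ?_⟩
    cases x with
    | s e =>
      exact norm_le_one_of_star_mul_self (hf.cuntzKrieger.projection _)
        (hf.cuntzKrieger.source_proj e)
    | p B => exact norm_le_one_of_isStarProjection (hf.cuntzKrieger.projection B)
    | u B g =>
      refine norm_le_one_of_star_mul_self
        (hf.cuntzKrieger.projection (g⁻¹ • B ∩ g⁻¹ • B)) ?_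
      rw [hf.u_star, hf.u_mul, inv_mul_cancel, hf.u_one]
  reflects A _ f I B _ π hπ h := by
    have hπ' : ∀ a b, (∀ i, π i a = π i b) → a = b := fun a b hab =>
      sub_eq_zero.1 (hπ _ fun i => by rw [map_sub, hab i, sub_self])
    exact
    { cuntzKrieger := .of_comp π hπ' fun i => (h i).cuntzKrieger
      u_one := fun C => hπ' _ _ fun i => by simpa [map_star] using (h i).u_one C
      u_star := fun C g => hπ' _ _ fun i => by simpa [map_star] using (h i).u_star C g
      u_mul := fun C D g k => hπ' _ _ fun i => by simpa [map_star] using (h i).u_mul C D g k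
      u_edge := fun C g e he => hπ' _ _ fun i => by simpa [map_star] using (h i).u_edge C g e he
      u_edge_zero := fun C g e he => hπ' _ _ fun i => by simpa [map_star] using (h i).u_edge_zero C g e he }

/-- The C*-algebra `𝒪_{G,U}`: the universal C*-algebra generated by a `(G, U)`-family. -/
abbrev CStar : Type (max u₁ u₂ u₃) := U.relations.Alg

/-- The canonical generators of `𝒪_{G,U}` form a `(G, U)`-family. -/
theorem isFamily_gen : U.IsFamily (fun e => U.relations.gen (.s e))
    (fun B => U.relations.gen (.p B)) (fun B g => U.relations.gen (.u B g)) :=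
  U.relations.holds_gen

/-- The universal property of `𝒪_{G,U}`. -/
theorem existsUnique_lift {B : Type (max u₁ u₂ u₃)} [NonUnitalCStarAlgebra B]
    {S : E → B} {P : U.VSet → B} {u : U.VSet → G → B} (h : U.IsFamily S P u) :
    ∃! ψ : U.CStar →⋆ₙₐ[ℂ] B, (∀ e, ψ (U.relations.gen (.s e)) = S e) ∧
      (∀ C, ψ (U.relations.gen (.p C)) = P C) ∧
      ∀ C g, ψ (U.relations.gen (.u C g)) = u C g := by
  let f : U.Letter → B := fun x => match x with
    | .s e => S e
    | .p C => P C
    | .u C g => u C g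
  obtain ⟨ψ, hψ⟩ := U.relations.exists_lift (B := B) (f := f) h
  refine ⟨ψ, ⟨fun e => hψ _, fun C => hψ _, fun C g => hψ _⟩, ?_⟩
  rintro χ ⟨h1, h2, h3⟩
  refine U.relations.hom_ext fun x => ?_
  rw [hψ]
  cases x with
  | s e => exact h1 e
  | p C => exact h2 C
  | u C g => exact h3 C g

/-! ### The universal unital C*-algebra with a unitary representation of `G` -/

/-- The letters `1`, `s_e`, `p_A` and `u_g`. -/
inductive UnitalLetter : Type (max u₁ u₂ u₃)
  | one
  | s (e : E)
  | p (A : U.VSet)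
  | u (g : G)

/-- The relations of a Cuntz-Krieger family and a unitary representation with covariance, where
the letter `one` stands for the unit of the algebra. -/
structure UnitalRelationsHold {A : Type*} [NonUnitalCStarAlgebra A] (f : U.UnitalLetter → A) :
    Prop where
  one_mul : ∀ a, f .one * a = a
  mul_one : ∀ a, a * f .one = a
  cuntzKrieger : U.IsCuntzKriegerFamily (fun e => f (.s e)) (fun B => f (.p B))
  u_star_mul : ∀ g, star (f (.u g)) * f (.u g) = f .one
  u_mul_star : ∀ g, f (.u g) * star (f (.u g)) = f .one
  u_one : f (.u 1) = f .one
  u_mul : ∀ g h, f (.u (g * h)) = f (.u g) * f (.u h)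
  u_proj : ∀ g B, f (.u g) * f (.p B) = f (.p (g • B)) * f (.u g)
  u_edge : ∀ g e, f (.u g) * f (.s e) = f (.s (g • e)) * f (.u (U.φ g e))

theorem UnitalRelationsHold.isStarProjection_one {A : Type*} [NonUnitalCStarAlgebra A]
    {f : U.UnitalLetter → A} (h : U.UnitalRelationsHold f) : IsStarProjection (f .one) where
  isIdempotentElem := h.one_mul _
  isSelfAdjoint := by
    have h1 := congrArg star (h.one_mul (star (f .one)))
    rw [star_mul, star_star, h.one_mul] at h1
    exact h1

/-- The defining relations of the universal unital C*-algebra `𝒟_{G,U}`. -/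
def unitalRelations : CStarRelations U.UnitalLetter where
  Holds _ _ f := U.UnitalRelationsHold f
  bounded x := by
    refine ⟨1, fun A _ f hf => ?_⟩
    cases x with
    | one => exact norm_le_one_of_isStarProjection hf.isStarProjection_one
    | s e =>
      exact norm_le_one_of_star_mul_self (hf.cuntzKrieger.projection _)
        (hf.cuntzKrieger.source_proj e)
    | p B => exact norm_le_one_of_isStarProjection (hf.cuntzKrieger.projection B)
    | u g => exact norm_le_one_of_star_mul_self hf.isStarProjection_one (hf.u_star_mul g)
  reflects A _ f I B _ π hπ h := by
    have hπ' : ∀ a b, (∀ i, π i a = π i b) → a = b := fun a b hab =>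
      sub_eq_zero.1 (hπ _ fun i => by rw [map_sub, hab i, sub_self])
    exact
    { one_mul := fun a => hπ' _ _ fun i => by simpa [map_star] using (h i).one_mul (π i a)
      mul_one := fun a => hπ' _ _ fun i => by simpa [map_star] using (h i).mul_one (π i a)
      cuntzKrieger := .of_comp π hπ' fun i => (h i).cuntzKrieger
      u_star_mul := fun g => hπ' _ _ fun i => by simpa [map_star] using (h i).u_star_mul g
      u_mul_star := fun g => hπ' _ _ fun i => by simpa [map_star] using (h i).u_mul_star g
      u_one := hπ' _ _ fun i => (h i).u_one
      u_mul := fun g k => hπ' _ _ fun i => by simpa [map_star] using (h i).u_mul g k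
      u_proj := fun g C => hπ' _ _ fun i => by simpa [map_star] using (h i).u_proj g C
      u_edge := fun g e => hπ' _ _ fun i => by simpa [map_star] using (h i).u_edge g e }

/-- The universal unital C*-algebra `𝒟_{G,U}`. -/
def UnitalCStar : Type (max u₁ u₂ u₃) := U.unitalRelations.Alg

section

/-- The C*-algebra `𝒟_{G,U}` without its unit. -/
@[reducible]
noncomputable def nonUnitalStructure : NonUnitalCStarAlgebra U.UnitalCStar :=
  inferInstanceAs (NonUnitalCStarAlgebra U.unitalRelations.Alg)

attribute [local instance] nonUnitalStructure

/-- The generators of `𝒟_{G,U}`. -/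
noncomputable def unitalGen (x : U.UnitalLetter) : U.UnitalCStar := U.unitalRelations.gen x

theorem unitalRelationsHold_gen : U.UnitalRelationsHold U.unitalGen :=
  U.unitalRelations.holds_gen

noncomputable instance : CStarAlgebra U.UnitalCStar :=
  { U.nonUnitalStructure with
    one := U.unitalGen .one
    one_mul := U.unitalRelationsHold_gen.one_mul
    mul_one := U.unitalRelationsHold_gen.mul_one
    toAlgebra :=
      letI : Ring U.UnitalCStar :=
        { (inferInstance : NonUnitalRing U.UnitalCStar) with
          one := U.unitalGen .one
          one_mul := U.unitalRelationsHold_gen.one_mul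
          mul_one := U.unitalRelationsHold_gen.mul_one }
      Algebra.ofModule smul_mul_assoc mul_smul_comm
    norm_smul_le := norm_smul_le }

end

noncomputable section

/-- The partial isometry `s_e` in `𝒟_{G,U}`. -/
def dS (e : E) : U.UnitalCStar := U.unitalGen (.s e)

/-- The projection `p_A` in `𝒟_{G,U}`. -/
def dP (A : U.VSet) : U.UnitalCStar := U.unitalGen (.p A)

/-- The unitary `u_g` in `𝒟_{G,U}`. -/
def dU (g : G) : U.UnitalCStar := U.unitalGen (.u g)

end

/-- The generators of `𝒟_{G,U}` satisfy the defining relations. -/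
theorem isUnitaryFamily_gen : U.IsUnitaryFamily U.dS U.dP U.dU where
  cuntzKrieger := U.unitalRelationsHold_gen.cuntzKrieger
  u_unitary g := Unitary.mem_iff.2 ⟨U.unitalRelationsHold_gen.u_star_mul g,
    U.unitalRelationsHold_gen.u_mul_star g⟩
  u_one := U.unitalRelationsHold_gen.u_one
  u_mul := U.unitalRelationsHold_gen.u_mul
  u_proj := U.unitalRelationsHold_gen.u_proj
  u_edge := U.unitalRelationsHold_gen.u_edge

/-- The universal property of `𝒟_{G,U}` among unital C*-algebras. -/
theorem existsUnique_unital_lift {B : Type (max u₁ u₂ u₃)} [CStarAlgebra B]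
    {S : E → B} {P : U.VSet → B} {u : G → B} (h : U.IsUnitaryFamily S P u) :
    ∃! ψ : U.UnitalCStar →⋆ₐ[ℂ] B,
      (∀ e, ψ (U.dS e) = S e) ∧ (∀ C, ψ (U.dP C) = P C) ∧ ∀ g, ψ (U.dU g) = u g := by
  let f : U.UnitalLetter → B := fun x => match x with
    | .one => 1
    | .s e => S e
    | .p C => P C
    | .u g => u g
  have hf : U.UnitalRelationsHold f :=
    { one_mul := _root_.one_mul
      mul_one := _root_.mul_one
      cuntzKrieger := h.cuntzKrieger
      u_star_mul := fun g => Unitary.star_mul_self_of_mem (h.u_unitary g)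
      u_mul_star := fun g => Unitary.mul_star_self_of_mem (h.u_unitary g)
      u_one := h.u_one
      u_mul := h.u_mul
      u_proj := h.u_proj
      u_edge := h.u_edge }
  obtain ⟨ψ, hψ⟩ := U.unitalRelations.exists_lift (B := B) (f := f) hf
  have h1 : ψ (1 : U.UnitalCStar) = 1 := hψ .one
  refine ⟨{ toFun := ψ, map_one' := h1, map_mul' := map_mul ψ, map_zero' := map_zero ψ,
            map_add' := map_add ψ, map_star' := map_star ψ,
            commutes' := fun c => ?_ }, ⟨fun e => hψ _, fun C => hψ _, fun g => hψ _⟩, ?_⟩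
  · rw [Algebra.algebraMap_eq_smul_one, Algebra.algebraMap_eq_smul_one, ← h1]
    exact map_smul ψ c (1 : U.UnitalCStar)
  · rintro χ ⟨e1, e2, e3⟩
    have hχ : (χ : U.UnitalCStar →⋆ₙₐ[ℂ] B) = ψ := by
      refine U.unitalRelations.hom_ext fun x => ?_
      rw [hψ]
      cases x with
      | one => exact map_one χ
      | s e => exact e1 e
      | p C => exact e2 C
      | u g => exact e3 g
    ext a
    exact DFunLike.congr_fun hχ a

/-- The closed linear span in `𝒟_{G,U}` of the elements `s_α p_A u_g s_β*` with finite paths `α`,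
`β` and a generalized vertex `A ⊆ s(α) ∩ g • s(β)`. -/
noncomputable def tildeSpan : Submodule ℂ U.UnitalCStar :=
  (Submodule.span ℂ {x | ∃ (α β : U.FinPath) (A : U.VSet) (g : G),
    A.val ⊆ α.source ∩ g • β.source ∧
      x = α.elem U.dS U.dP * U.dP A * U.dU g * star (β.elem U.dS U.dP)}).topologicalClosure

end SelfSimilarUltragraph

/-! In `𝒟_{G,U}` the elements `p_A u_g` satisfy the relations imposed on `u_{A,g}`, so the universal
property gives a homomorphism `ψ : 𝒪_{G,U} → 𝒟_{G,U}`. It remains to see that `ψ` is injective with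
range the closed span of the monomials `s_α p_A u_g s_β*`.

Injectivity: `𝒪_{G,U}` has no elements `u_g`, but its multiplier algebra does. The elements having a
left support projection `p_B` are dense (`dense_supported_gen`). On an element with support `B`,
left multiplication by `u_{g•B,g}` does not depend on `B`, so these operators glue to a unitary
multiplier, the strict limit of the `u_{B,g}`. Together with the copies of `s_e` and `p_A` these
multipliers form a unitary family (`isUnitaryFamily_multiplier`), which yields `π : 𝒟_{G,U} →
M(𝒪_{G,U})`. On generators `π ∘ ψ` is the canonical embedding, hence `ψ` is injective, therefore
isometric with closed range.

Range: every monomial is a product of images of generators and their adjoints. Conversely, left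
multiplication by generators and their adjoints preserves the closed span (the decisive case is
`star_edge_mul_mem`), so the span contains the image of every `*`-polynomial
(`eval_mem_closedSpan`). -/

namespace Ultragraph

variable {V E : Type*} {U : Ultragraph V E}

namespace VSet

@[simp] theorem val_inter (A B : U.VSet) : (A ∩ B).val = A.val ∩ B.val := rfl
@[simp] theorem val_singleton (v : V) : ({v} : U.VSet).val = {v} := rfl

theorem inter_eq_right {A B : U.VSet} (h : B.val ⊆ A.val) : A ∩ B = B :=
  VSet.ext (Set.inter_eq_right.2 h)

theorem inter_eq_left {A B : U.VSet} (h : A.val ⊆ B.val) : A ∩ B = A :=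
  VSet.ext (Set.inter_eq_left.2 h)

end VSet

/-! ### Consequences of the Cuntz–Krieger relations. -/

namespace IsCuntzKriegerFamily

variable {A : Type*} [NonUnitalCStarAlgebra A] {S : E → A} {P : U.VSet → A}

theorem star_proj (h : U.IsCuntzKriegerFamily S P) (B : U.VSet) : star (P B) = P B :=
  (h.projection B).isSelfAdjoint.star_eq

theorem proj_mul_self (h : U.IsCuntzKriegerFamily S P) (B : U.VSet) : P B * P B = P B :=
  (h.projection B).isIdempotentElem.eq

theorem proj_mul_of_subset (h : U.IsCuntzKriegerFamily S P) {B C : U.VSet}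
    (hBC : C.val ⊆ B.val) : P B * P C = P C := by
  rw [h.map_inter, VSet.inter_eq_right hBC]

theorem edge_mul_src (h : U.IsCuntzKriegerFamily S P) (e : E) : S e * P (U.src e) = S e := by
  rw [← h.source_proj, ← mul_assoc, h.partial_isometry]

theorem src_mul_star_edge (h : U.IsCuntzKriegerFamily S P) (e : E) :
    P (U.src e) * star (S e) = star (S e) := by
  have := congrArg star (h.edge_mul_src e)
  rwa [star_mul, h.star_proj] at this

theorem range_mul_edge (h : U.IsCuntzKriegerFamily S P) (e : E) : P {U.r e} * S e = S e := by
  have := congrArg (· * S e) (h.range_le e)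
  simpa only [mul_assoc, ← mul_assoc (S e), h.partial_isometry] using this

theorem proj_mul_edge (h : U.IsCuntzKriegerFamily S P) {e : E} {B : U.VSet}
    (he : U.r e ∈ B.val) : P B * S e = S e := by
  rw [← h.range_mul_edge e, ← mul_assoc, h.proj_mul_of_subset (by simpa using he)]

theorem proj_mul_edge_eq_zero (h : U.IsCuntzKriegerFamily S P) {e : E} {B : U.VSet}
    (he : U.r e ∉ B.val) : P B * S e = 0 := by
  have h0 : B ∩ {U.r e} = (∅ : U.VSet) :=
    VSet.ext (Set.inter_singleton_eq_empty.2 he)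
  rw [← h.range_mul_edge e, ← mul_assoc, h.map_inter, h0, h.map_empty, zero_mul]

/-- Writing `s_e* = s_e* s_e s_e*` and `s_f = s_f s_f* s_f` exposes the product of the two
orthogonal range projections. -/
theorem star_edge_mul_edge (h : U.IsCuntzKriegerFamily S P) {e f : E} (hef : e ≠ f) :
    star (S e) * S f = 0 := by
  have h1 : star (S e) = star (S e) * S e * star (S e) := by
    rw [h.source_proj, h.src_mul_star_edge]
  have h2 : star (S e) * ((S e * star (S e)) * (S f * star (S f))) * S f = 0 := by
    rw [h.orthogonal_ranges e f hef, mul_zero, zero_mul]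
  rw [h1, ← h.partial_isometry f]
  simpa only [mul_assoc] using h2

theorem edge_mul_edge_eq_zero (h : U.IsCuntzKriegerFamily S P) {e f : E}
    (hf : U.r f ∉ U.s e) : S e * S f = 0 := by
  rw [← h.edge_mul_src e, mul_assoc, h.proj_mul_edge_eq_zero hf, mul_zero]

theorem map {B : Type*} [NonUnitalCStarAlgebra B] (h : U.IsCuntzKriegerFamily S P)
    (π : A →⋆ₙₐ[ℂ] B) : U.IsCuntzKriegerFamily (fun e => π (S e)) (fun C => π (P C)) where
  partial_isometry e := by simp only [← map_star, ← map_mul, h.partial_isometry]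
  orthogonal_ranges e f hef := by
    simp only [← map_star, ← map_mul, h.orthogonal_ranges e f hef, map_zero]
  projection C := (h.projection C).map π
  map_empty := by rw [h.map_empty, map_zero]
  map_inter C D := by rw [← map_mul, h.map_inter]
  map_union C D := by rw [h.map_union, map_sub, map_add]
  source_proj e := by rw [← map_star, ← map_mul, h.source_proj]
  range_le e := by simp only [← map_star, ← map_mul, h.range_le]
  vertex_sum v hf hne := by
    simp only [h.vertex_sum v hf hne, map_sum, map_mul, map_star]

end IsCuntzKriegerFamily

/-- Appending an edge to a finite path. -/
theorem FinPath.exists_snoc {D : Type*} [CStarAlgebra D] {S : E → D} {P : U.VSet → D}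
    (h : U.IsCuntzKriegerFamily S P) (β : U.FinPath) {f : E} (hf : U.r f ∈ β.source) :
    ∃ γ : U.FinPath, γ.elem S P = β.elem S P * S f ∧ γ.source = U.s f := by
  cases β with
  | vertex A =>
    exact ⟨.edges [f] (by simp) (by simp), by
      simpa [FinPath.elem] using (h.proj_mul_edge hf).symm, rfl⟩
  | edges l ne hl =>
    refine ⟨.edges (l ++ [f]) (by simp) ?_, by simp [FinPath.elem], by simp [FinPath.source]⟩
    refine hl.append (by simp) ?_
    intro x hx y hy
    rw [List.getLast?_eq_some_getLast ne] at hx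
    simp only [Option.mem_def, Option.some.injEq, List.head?_cons] at hx hy
    subst hx hy
    exact hf

end Ultragraph

/-! ### The group action on generalized vertices and on paths. -/

namespace SelfSimilarUltragraph

universe u₁ u₂ u₃

variable {G : Type u₁} {V : Type u₂} {E : Type u₃} [Group G] [MulAction G V] [MulAction G E]
  (U : SelfSimilarUltragraph G V E)

@[simp] theorem val_smul (g : G) (A : U.VSet) : (g • A).val = g • A.val := rfl

instance : MulAction G U.VSet where
  one_smul A := Ultragraph.VSet.ext (one_smul G A.val)
  mul_smul g h A := Ultragraph.VSet.ext (mul_smul g h A.val)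

theorem φ_one (e : E) : U.φ 1 e = 1 := by
  simpa using U.cocycle 1 1 e

/-- The inclusion in the axiom on the cocycle is automatically an equality. -/
theorem φ_smul_source (g : G) (e : E) : U.φ g e • U.s e = g • U.s e := by
  refine (U.cocycle_source g e).antisymm ?_
  -- The axiom at `g⁻¹` and `g • e`, where the cocycle takes the value `φ(g,e)⁻¹`, is the reverse
  -- inclusion.
  have h1 := U.cocycle_source g⁻¹ (g • e)
  have h2 : U.φ g⁻¹ (g • e) = (U.φ g e)⁻¹ := by
    rw [eq_inv_iff_mul_eq_one, ← U.cocycle, inv_mul_cancel, U.φ_one]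
  rwa [h2, U.s_smul, inv_smul_smul, Set.smul_set_subset_iff_subset_inv_smul_set, inv_inv] at h1

theorem src_smul (g : G) (e : E) : U.src (g • e) = g • U.src e :=
  Ultragraph.VSet.ext (U.s_smul g e)

/-- The action of `G` on words of edges. -/
def wordSMul : G → List E → List E
  | _, [] => []
  | g, e :: l => (g • e) :: wordSMul (U.φ g e) l

/-- The extension of the cocycle to words of edges. -/
def wordCocycle : G → List E → G
  | g, [] => g
  | g, e :: l => wordCocycle (U.φ g e) l

/-- After an edge `e` moved by `g`, the next edge is moved by `φ(g,e)`; composability survives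
because `φ(g,e)` and `g` send `s(e)` to the same set. -/
theorem isChain_wordSMul (g : G) (l : List E) (hl : l.IsChain fun e f => U.r f ∈ U.s e) :
    (U.wordSMul g l).IsChain fun e f => U.r f ∈ U.s e := by
  induction l generalizing g with
  | nil => simp [wordSMul]
  | cons e l ih =>
    cases l with
    | nil => simp [wordSMul]
    | cons f l =>
      rw [List.isChain_cons_cons] at hl
      simp only [wordSMul, List.isChain_cons_cons]
      refine ⟨?_, ih (U.φ g e) hl.2⟩
      rw [U.r_smul, U.s_smul, ← U.φ_smul_source]
      exact Set.smul_mem_smul_set hl.1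

theorem wordSMul_ne_nil (g : G) {l : List E} (hl : l ≠ []) : U.wordSMul g l ≠ [] := by
  cases l with
  | nil => exact absurd rfl hl
  | cons e l => simp [wordSMul]

theorem source_wordSMul (g : G) (l : List E) (hl : l ≠ []) :
    U.s ((U.wordSMul g l).getLast (U.wordSMul_ne_nil g hl)) =
      U.wordCocycle g l • U.s (l.getLast hl) := by
  induction l generalizing g with
  | nil => exact absurd rfl hl
  | cons e l ih =>
    cases l with
    | nil => simp [wordSMul, wordCocycle, U.s_smul, U.φ_smul_source]
    | cons f l => simpa [wordSMul, wordCocycle] using ih (U.φ g e) (by simp)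

namespace IsUnitaryFamily

variable {U} {D : Type*} [CStarAlgebra D] {S : E → D} {P : U.VSet → D} {u : G → D}

theorem star_u (h : U.IsUnitaryFamily S P u) (g : G) : star (u g) = u g⁻¹ := by
  have h1 : u g * u g⁻¹ = 1 := by rw [← h.u_mul, mul_inv_cancel, h.u_one]
  calc star (u g) = star (u g) * (u g * u g⁻¹) := by rw [h1, mul_one]
    _ = u g⁻¹ := by rw [← mul_assoc, Unitary.star_mul_self_of_mem (h.u_unitary g), one_mul]

/-- This is what produces the homomorphism `𝒪_{G,U} → 𝒟_{G,U}`. In the edge relation the extra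
projection is absorbed: `s_{g•e} p_{g•s(e)} = s_{g•e}`. -/
theorem isFamily (h : U.IsUnitaryFamily S P u) : U.IsFamily S P (fun B g => P B * u g) where
  cuntzKrieger := h.cuntzKrieger
  u_one B := by rw [h.u_one, mul_one]
  u_star B g := by rw [star_mul, h.star_u, h.cuntzKrieger.star_proj, h.u_proj]
  u_mul B C g k := by
    rw [mul_assoc, ← mul_assoc (u g), h.u_proj, mul_assoc, ← h.u_mul, ← mul_assoc,
      h.cuntzKrieger.map_inter]
  u_edge B g e he := by
    rw [mul_assoc, h.u_edge, ← mul_assoc, h.cuntzKrieger.proj_mul_edge (by rwa [U.r_smul]),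
      ← mul_assoc, ← U.src_smul, h.cuntzKrieger.edge_mul_src]
  u_edge_zero B g e he := by
    rw [mul_assoc, h.u_edge, ← mul_assoc,
      h.cuntzKrieger.proj_mul_edge_eq_zero (by rwa [U.r_smul]), zero_mul]

theorem u_mul_word (h : U.IsUnitaryFamily S P u) (g : G) (l : List E) :
    u g * (l.map S).prod = ((U.wordSMul g l).map S).prod * u (U.wordCocycle g l) := by
  induction l generalizing g with
  | nil => simp [wordSMul, wordCocycle]
  | cons e l ih =>
    simp only [wordSMul, wordCocycle, List.map_cons, List.prod_cons]
    rw [← mul_assoc, h.u_edge, mul_assoc, ih, mul_assoc]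

/-- Lets a unitary pass through `s_α` into the middle of a monomial. The source equality keeps the
constraint on the middle projection intact. -/
theorem exists_u_mul_elem (h : U.IsUnitaryFamily S P u) (g : G) (α : U.FinPath) :
    ∃ (γ : U.FinPath) (k : G), u g * α.elem S P = γ.elem S P * u k ∧
      γ.source = k • α.source := by
  cases α with
  | vertex B => exact ⟨.vertex (g • B), g, h.u_proj g B, rfl⟩
  | edges l ne hl =>
    exact ⟨.edges (U.wordSMul g l) (U.wordSMul_ne_nil g ne) (U.isChain_wordSMul g l hl),
      U.wordCocycle g l, h.u_mul_word g l, U.source_wordSMul g l ne⟩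

end IsUnitaryFamily

/-! ### The closed span of the monomials and its stability under left multiplication. -/

section Monomials

variable {U} {D : Type*} [CStarAlgebra D]

/-- The elements `s_α p_A u_g s_β*` with `A ⊆ s(α) ∩ g • s(β)`. -/
def monomials (S : E → D) (P : U.VSet → D) (u : G → D) : Set D :=
  {x | ∃ (α β : U.FinPath) (A : U.VSet) (g : G), A.val ⊆ α.source ∩ g • β.source ∧
    x = α.elem S P * P A * u g * star (β.elem S P)}

namespace IsUnitaryFamily

variable {S : E → D} {P : U.VSet → D} {u : G → D}

/-- Taking adjoints exchanges `α` and `β`; moving `p_A` back to the left of `u_{g⁻¹}` turns it into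
`p_{g⁻¹•A}`. -/
theorem star_mem_monomials (h : U.IsUnitaryFamily S P u) {x : D} (hx : x ∈ monomials S P u) :
    star x ∈ monomials S P u := by
  obtain ⟨α, β, A, g, hA, rfl⟩ := hx
  refine ⟨β, α, g⁻¹ • A, g⁻¹, ?_, ?_⟩
  · rw [val_smul, Set.smul_set_subset_iff_subset_inv_smul_set, inv_inv, Set.smul_set_inter,
      smul_inv_smul, Set.inter_comm]
    exact hA
  · simp only [star_mul, star_star, h.star_u, h.cuntzKrieger.star_proj, mul_assoc]
    rw [← mul_assoc (u g⁻¹), h.u_proj, mul_assoc]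

theorem u_mul_mem (h : U.IsUnitaryFamily S P u) (k : G) {x : D} (hx : x ∈ monomials S P u) :
    u k * x ∈ monomials S P u := by
  obtain ⟨α, β, A, g, hA, rfl⟩ := hx
  obtain ⟨γ, k', hγ, hs⟩ := h.exists_u_mul_elem k α
  refine ⟨γ, β, k' • A, k' * g, ?_, ?_⟩
  · rw [hs, mul_smul, ← Set.smul_set_inter]
    exact Set.smul_set_mono hA
  · simp only [← mul_assoc]
    rw [hγ, mul_assoc _ (u k'), h.u_proj, h.u_mul]
    simp only [mul_assoc]

/-- If `α` has length zero, `p_B` shrinks `A`; otherwise it fixes or kills the first edge. -/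
theorem proj_mul_mem (h : U.IsUnitaryFamily S P u) (B : U.VSet) {x : D}
    (hx : x ∈ monomials S P u) : P B * x ∈ Submodule.span ℂ (monomials S P u) := by
  obtain ⟨α, β, A, g, hA, rfl⟩ := hx
  have hc := h.cuntzKrieger
  cases α with
  | vertex C =>
    refine Submodule.subset_span ⟨.vertex C, β, B ∩ A, g, Set.inter_subset_right.trans hA, ?_⟩
    have hAC : A.val ⊆ C.val := hA.trans Set.inter_subset_left
    simp only [Ultragraph.FinPath.elem, ← mul_assoc]
    rw [hc.map_inter B C, hc.map_inter, hc.map_inter]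
    congr 3
    ext v
    simp only [Ultragraph.VSet.val_inter, Set.mem_inter_iff]
    tauto
  | edges l ne hl =>
    cases l with
    | nil => exact absurd rfl ne
    | cons f l =>
      simp only [Ultragraph.FinPath.elem, List.map_cons, List.prod_cons, ← mul_assoc]
      by_cases hf : U.r f ∈ B.val
      · rw [hc.proj_mul_edge hf]
        exact Submodule.subset_span ⟨.edges (f :: l) ne hl, β, A, g, hA, by
          simp only [Ultragraph.FinPath.elem, List.map_cons, List.prod_cons]⟩
      · rw [hc.proj_mul_edge_eq_zero hf]
        simp

theorem edge_mul_mem (h : U.IsUnitaryFamily S P u) (e : E) {x : D}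
    (hx : x ∈ monomials S P u) : S e * x ∈ Submodule.span ℂ (monomials S P u) := by
  obtain ⟨α, β, A, g, hA, rfl⟩ := hx
  have hc := h.cuntzKrieger
  cases α with
  | vertex C =>
    -- Since `A ⊆ C`, the factor `p_C` disappears, and `s_e p_A = s_e p_{s(e) ∩ A}` brings the
    -- projection below `s(e)`.
    refine Submodule.subset_span ⟨.edges [e] (by simp) (by simp), β, U.src e ∩ A, g,
      Set.inter_subset_inter subset_rfl (hA.trans Set.inter_subset_right), ?_⟩
    simp only [Ultragraph.FinPath.elem, ← mul_assoc, List.map_cons, List.map_nil, List.prod_cons,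
      List.prod_nil, mul_one]
    rw [mul_assoc (S e), hc.proj_mul_of_subset (hA.trans Set.inter_subset_left), ← hc.map_inter,
      ← mul_assoc, hc.edge_mul_src]
  | edges l ne hl =>
    cases l with
    | nil => exact absurd rfl ne
    | cons f l =>
      by_cases hf : U.r f ∈ U.s e
      · exact Submodule.subset_span ⟨.edges (e :: f :: l) (by simp)
          (List.isChain_cons_cons.2 ⟨hf, hl⟩), β, A, g, by
            simpa [Ultragraph.FinPath.source] using hA, by
          simp only [Ultragraph.FinPath.elem, List.map_cons, List.prod_cons, mul_assoc]⟩
      · simp only [Ultragraph.FinPath.elem, List.map_cons, List.prod_cons, ← mul_assoc]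
        rw [hc.edge_mul_edge_eq_zero hf]
        simp

/-- If `α` begins with an edge, `s_e*` cancels it or kills it. If `α` has length zero, there is
nothing to cancel and `s_e*` must travel right: `s_e* p_A` is `s_e*` or `0`, and `s_e* u_g = u_k
s_f*` with `f = g⁻¹ • e`, `k = φ(g⁻¹,e)⁻¹`, so that `f` is appended to `β`. -/
theorem star_edge_mul_mem (h : U.IsUnitaryFamily S P u) (e : E) {x : D}
    (hx : x ∈ monomials S P u) : star (S e) * x ∈ Submodule.span ℂ (monomials S P u) := by
  obtain ⟨α, β, A, g, hA, rfl⟩ := hx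
  have hc := h.cuntzKrieger
  cases α with
  | vertex C =>
    simp only [Ultragraph.FinPath.elem]
    rw [hc.proj_mul_of_subset (hA.trans Set.inter_subset_left), ← mul_assoc, ← mul_assoc]
    have hs : star (S e) * P A = star (P A * S e) := by rw [star_mul, hc.star_proj]
    rw [hs]
    by_cases he : U.r e ∈ A.val
    · have hr : U.r (g⁻¹ • e) ∈ β.source := by
        rw [U.r_smul, ← Set.mem_smul_set_iff_inv_smul_mem]
        exact (hA he).2
      obtain ⟨γ, hγ, hsrc⟩ := Ultragraph.FinPath.exists_snoc hc β hr
      set f := g⁻¹ • e with hf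
      set k := (U.φ g⁻¹ e)⁻¹ with hk
      have h1 : star (S e) * u g = P (k • U.src f) * u k * star (S f) := by
        -- The adjoint of the covariance relation for `g⁻¹` and `e`.
        have h2 := congrArg star (h.u_edge g⁻¹ e)
        rw [star_mul, star_mul, h.star_u, h.star_u, inv_inv] at h2
        rw [h2, ← h.u_proj, mul_assoc (u k), hc.src_mul_star_edge]
      refine Submodule.subset_span ⟨.vertex (k • U.src f), γ, k • U.src f, k, ?_, ?_⟩
      · rw [hsrc]
        exact Set.subset_inter subset_rfl subset_rfl
      · rw [hc.proj_mul_edge he, hγ, h1]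
        simp only [Ultragraph.FinPath.elem, star_mul, mul_assoc]
        rw [← mul_assoc (P _) (P _), hc.proj_mul_self]
    · rw [hc.proj_mul_edge_eq_zero he]
      simp
  | edges l ne hl =>
    cases l with
    | nil => exact absurd rfl ne
    | cons f l =>
      simp only [Ultragraph.FinPath.elem, List.map_cons, List.prod_cons, ← mul_assoc]
      by_cases hef : e = f
      · subst hef
        rw [hc.source_proj]
        cases l with
        | nil =>
          exact Submodule.subset_span ⟨.vertex (U.src e), β, A, g, hA, by
            simp [Ultragraph.FinPath.elem]⟩
        | cons f l =>
          rw [List.isChain_cons_cons] at hl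
          refine Submodule.subset_span ⟨.edges (f :: l) (by simp) hl.2, β, A, g, by
            simpa [Ultragraph.FinPath.source] using hA, ?_⟩
          simp only [Ultragraph.FinPath.elem, List.map_cons, List.prod_cons, ← mul_assoc]
          rw [hc.proj_mul_edge hl.1]
      · rw [hc.star_edge_mul_edge hef]
        simp

/-- The closed linear span of the monomials. -/
noncomputable def closedSpan (_ : U.IsUnitaryFamily S P u) : Submodule ℂ D :=
  (Submodule.span ℂ (monomials S P u)).topologicalClosure

theorem mul_mem_closedSpan (h : U.IsUnitaryFamily S P u) {y : D}
    (hy : ∀ x ∈ monomials S P u, y * x ∈ Submodule.span ℂ (monomials S P u)) {x : D}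
    (hx : x ∈ h.closedSpan) : y * x ∈ h.closedSpan := by
  refine map_mem_closure (f := fun x => y * x) (continuous_const_mul y) hx fun z hz => ?_
  have : Submodule.span ℂ (monomials S P u) ≤
      (Submodule.span ℂ (monomials S P u)).comap (LinearMap.mulLeft ℂ y) :=
    Submodule.span_le.2 hy
  exact this hz

theorem star_mem_closedSpan (h : U.IsUnitaryFamily S P u) {x : D} (hx : x ∈ h.closedSpan) :
    star x ∈ h.closedSpan := by
  refine map_mem_closure (f := star) continuous_star hx fun z hz => ?_
  induction hz using Submodule.span_induction with
  | mem x hx => exact Submodule.subset_span (h.star_mem_monomials hx)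
  | zero => simp
  | add x y _ _ hx hy => rw [star_add]; exact add_mem hx hy
  | smul c x _ hx => rw [star_smul]; exact Submodule.smul_mem _ _ hx

theorem u_mul_mem_closedSpan (h : U.IsUnitaryFamily S P u) (g : G) {x : D}
    (hx : x ∈ h.closedSpan) : u g * x ∈ h.closedSpan :=
  h.mul_mem_closedSpan (fun _ hz => Submodule.subset_span (h.u_mul_mem g hz)) hx

theorem proj_mul_mem_closedSpan (h : U.IsUnitaryFamily S P u) (B : U.VSet) {x : D}
    (hx : x ∈ h.closedSpan) : P B * x ∈ h.closedSpan :=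
  h.mul_mem_closedSpan (fun _ hz => h.proj_mul_mem B hz) hx

theorem proj_mul_u_mem_closedSpan (h : U.IsUnitaryFamily S P u) (B : U.VSet) (g : G) :
    P B * u g ∈ h.closedSpan := by
  -- The witnesses come from `p_B u_g = p_B p_B u_g p_{g⁻¹•B}`.
  refine Submodule.le_topologicalClosure _ (Submodule.subset_span
    ⟨.vertex B, .vertex (g⁻¹ • B), B, g, ?_, ?_⟩)
  · simp [Ultragraph.FinPath.source]
  · simp only [Ultragraph.FinPath.elem]
    rw [h.cuntzKrieger.star_proj, h.cuntzKrieger.proj_mul_self, mul_assoc, h.u_proj,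
      smul_inv_smul, ← mul_assoc, h.cuntzKrieger.proj_mul_self]

theorem proj_mem_closedSpan (h : U.IsUnitaryFamily S P u) (B : U.VSet) : P B ∈ h.closedSpan := by
  simpa [h.u_one] using h.proj_mul_u_mem_closedSpan B 1

theorem edge_mem_closedSpan (h : U.IsUnitaryFamily S P u) (e : E) : S e ∈ h.closedSpan := by
  rw [← h.cuntzKrieger.edge_mul_src e]
  exact h.mul_mem_closedSpan (fun _ hz => h.edge_mul_mem e hz) (h.proj_mem_closedSpan _)

end IsUnitaryFamily

/-- The letters of `𝒪_{G,U}` in the algebra generated by a unitary family. -/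
noncomputable def letterValue (S : E → D) (P : U.VSet → D) (u : G → D) : U.Letter → D
  | .s e => S e
  | .p B => P B
  | .u B g => P B * u g

/-- The induction carries left multiplication by the polynomial and by its adjoint: the former puts
a product `ab` in the span, since `a` multiplies `b` into it, and the adjoint case interchanges the
two. Right multiplication is never needed. -/
theorem IsUnitaryFamily.eval_mem_closedSpan {S : E → D} {P : U.VSet → D} {u : G → D}
    (h : U.IsUnitaryFamily S P u) (a : StarPoly U.Letter) :
    a.eval (letterValue S P u) ∈ h.closedSpan ∧
      (∀ x ∈ h.closedSpan, a.eval (letterValue S P u) * x ∈ h.closedSpan) ∧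
      ∀ x ∈ h.closedSpan, star (a.eval (letterValue S P u)) * x ∈ h.closedSpan := by
  induction a with
  | gen y =>
    cases y with
    | s e =>
      exact ⟨h.edge_mem_closedSpan e,
        fun _ hx => h.mul_mem_closedSpan (fun _ hz => h.edge_mul_mem e hz) hx,
        fun _ hx => h.mul_mem_closedSpan (fun _ hz => h.star_edge_mul_mem e hz) hx⟩
    | p B =>
      refine ⟨h.proj_mem_closedSpan B, fun _ hx => h.proj_mul_mem_closedSpan B hx,
        fun _ hx => ?_⟩
      simp only [StarPoly.eval, letterValue]
      rw [h.cuntzKrieger.star_proj]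
      exact h.proj_mul_mem_closedSpan B hx
    | u B g =>
      refine ⟨h.proj_mul_u_mem_closedSpan B g, fun x hx => ?_, fun x hx => ?_⟩ <;>
        simp only [StarPoly.eval, letterValue]
      · rw [mul_assoc]
        exact h.proj_mul_mem_closedSpan B (h.u_mul_mem_closedSpan g hx)
      · rw [star_mul, h.star_u, h.cuntzKrieger.star_proj, mul_assoc]
        exact h.u_mul_mem_closedSpan _ (h.proj_mul_mem_closedSpan B hx)
  | zero => simp [StarPoly.eval]
  | add a b ha hb =>
    simp only [StarPoly.eval, add_mul, star_add]
    exact ⟨add_mem ha.1 hb.1, fun x hx => add_mem (ha.2.1 x hx) (hb.2.1 x hx),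
      fun x hx => add_mem (ha.2.2 x hx) (hb.2.2 x hx)⟩
  | mul a b ha hb =>
    simp only [StarPoly.eval, mul_assoc, star_mul]
    exact ⟨ha.2.1 _ hb.1, fun x hx => ha.2.1 _ (hb.2.1 x hx),
      fun x hx => hb.2.2 _ (ha.2.2 x hx)⟩
  | smul c a ha =>
    simp only [StarPoly.eval, smul_mul_assoc, star_smul]
    exact ⟨Submodule.smul_mem _ _ ha.1, fun x hx => Submodule.smul_mem _ _ (ha.2.1 x hx),
      fun x hx => Submodule.smul_mem _ _ (ha.2.2 x hx)⟩
  | adj a ha =>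
    simp only [StarPoly.eval, star_star]
    exact ⟨h.star_mem_closedSpan ha.1, ha.2.2, ha.2.1⟩

end Monomials

end SelfSimilarUltragraph

/-! ### Double centralizers of a C*-algebra. -/

theorem DoubleCentralizer.ext_fst {A : Type*} [NonUnitalCStarAlgebra A]
    {a b : DoubleCentralizer ℂ A} (h : ∀ x, a.fst x = b.fst x) : a = b := by
  refine DoubleCentralizer.ext ℂ A a b (Prod.ext (ContinuousLinearMap.ext h)
    (ContinuousLinearMap.ext fun x => ?_))
  -- The left operator determines the right one through `snd x * y = x * fst y`; taking for `y` the
  -- adjoint of the difference makes it vanish.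
  have h1 : ∀ y, (a.snd x - b.snd x) * y = 0 := fun y => by
    rw [sub_mul, a.central, b.central, h, sub_self]
  exact sub_eq_zero.1 ((CStarRing.mul_star_self_eq_zero_iff _).1 (h1 _))

theorem DoubleCentralizer.coeHom_injective {A : Type*} [NonUnitalCStarAlgebra A] :
    Function.Injective (DoubleCentralizer.coeHom (𝕜 := ℂ) (A := A)) := by
  refine (injective_iff_map_eq_zero _).2 fun a ha => ?_
  have h : a * star a = 0 := congrArg (fun m : DoubleCentralizer ℂ A => m.fst (star a)) ha
  exact (CStarRing.mul_star_self_eq_zero_iff a).1 h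

namespace SelfSimilarUltragraph

universe u₁ u₂ u₃

variable {G : Type u₁} {V : Type u₂} {E : Type u₃} [Group G] [MulAction G V] [MulAction G E]
  {U : SelfSimilarUltragraph G V E}

/-! ### Unitary multipliers attached to a non-degenerate family. -/

namespace IsFamily

section

variable {A : Type*} [NonUnitalCStarAlgebra A] {S : E → A} {P : U.VSet → A}
  {u : U.VSet → G → A}

theorem proj_mul_u (h : U.IsFamily S P u) (B C : U.VSet) (g : G) :
    P B * u C g = u (B ∩ C) g := by
  rw [← h.u_one, h.u_mul, one_smul, one_mul]

theorem u_mul_proj (h : U.IsFamily S P u) (B C : U.VSet) (g : G) :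
    u B g * P C = u (B ∩ g • C) g := by
  rw [← h.u_one, h.u_mul, mul_one]

theorem norm_u_le (h : U.IsFamily S P u) (B : U.VSet) (g : G) : ‖u B g‖ ≤ 1 := by
  refine norm_le_one_of_star_mul_self
    (h.cuntzKrieger.projection (g⁻¹ • B ∩ g⁻¹ • B)) ?_
  rw [h.u_star, h.u_mul, inv_mul_cancel, h.u_one]

/-- The elements supported on some generalized vertex. -/
def supported (h : U.IsFamily S P u) : Submodule ℂ A where
  carrier := {x | ∃ B, P B * x = x}
  zero_mem' := ⟨∅, mul_zero _⟩
  add_mem' := by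
    rintro x y ⟨B, hx⟩ ⟨C, hy⟩
    refine ⟨B ∪ C, ?_⟩
    rw [mul_add]
    nth_rewrite 1 [← hx]
    nth_rewrite 1 [← hy]
    rw [← mul_assoc, ← mul_assoc, h.cuntzKrieger.proj_mul_of_subset Set.subset_union_left,
      h.cuntzKrieger.proj_mul_of_subset Set.subset_union_right, hx, hy]
  smul_mem' := by
    rintro c x ⟨B, hx⟩
    exact ⟨B, by rw [mul_smul_comm, hx]⟩

/-- Left multiplication by `u_{g • B, g}` does not depend on the support `B`. -/
theorem u_mul_eq_of_supported (h : U.IsFamily S P u) (g : G) {B C : U.VSet} {x : A}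
    (hB : P B * x = x) (hC : P C * x = x) : u (g • B) g * x = u (g • C) g * x := by
  calc u (g • B) g * x = u (g • B ∩ g • C) g * x := by
        rw [← h.u_mul_proj, mul_assoc, hC]
    _ = u (g • C ∩ g • B) g * x := by
        congr 2
        exact Ultragraph.VSet.ext (Set.inter_comm _ _)
    _ = u (g • C) g * x := by rw [← h.u_mul_proj, mul_assoc, hB]

/-- The map is well defined by `u_mul_eq_of_supported`, additive because two elements share the
support `B ∪ C`, and contractive because `‖u_{B,g}‖ ≤ 1`; density extends it to the whole algebra.
-/
theorem exists_leftMul (h : U.IsFamily S P u) (hd : Dense (h.supported : Set A)) (g : G) :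
    ∃ L : A →L[ℂ] A, ∀ B x, P B * x = x → L x = u (g • B) g * x := by
  have key : ∀ (x : h.supported) (B : U.VSet), P B * (x : A) = x →
      u (g • x.2.choose) g * (x : A) = u (g • B) g * (x : A) := fun x B hB =>
    h.u_mul_eq_of_supported g x.2.choose_spec hB
  let f : h.supported →ₗ[ℂ] A :=
    { toFun := fun x => u (g • x.2.choose) g * (x : A)
      map_add' := fun x y => by
        have hs : ∀ (B C : U.VSet) (z : A), B.val ⊆ C.val → P B * z = z → P C * z = z :=
          fun B C z hBC hz => by
            rw [← hz, ← mul_assoc, h.cuntzKrieger.proj_mul_of_subset hBC]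
        have hx := hs _ (x.2.choose ∪ y.2.choose) _ Set.subset_union_left x.2.choose_spec
        have hy := hs _ (x.2.choose ∪ y.2.choose) _ Set.subset_union_right y.2.choose_spec
        rw [key x _ hx, key y _ hy, key (x + y) (x.2.choose ∪ y.2.choose)
          (by rw [Submodule.coe_add, mul_add, hx, hy]), Submodule.coe_add, mul_add]
      map_smul' := fun c x => by
        rw [key (c • x) x.2.choose
          (by rw [Submodule.coe_smul, mul_smul_comm, x.2.choose_spec]), Submodule.coe_smul,
          mul_smul_comm]
        rfl }
  have hdr : DenseRange h.supported.subtype := by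
    simpa [DenseRange] using hd
  have hn : ∃ C : ℝ, ∀ x, ‖f x‖ ≤ C * ‖h.supported.subtype x‖ :=
    ⟨1, fun x => (norm_mul_le _ _).trans (mul_le_mul_of_nonneg_right (h.norm_u_le _ _)
      (norm_nonneg _))⟩
  refine ⟨f.extendOfNorm h.supported.subtype, fun B x hx => ?_⟩
  exact (LinearMap.extendOfNorm_eq hdr hn ⟨x, B, hx⟩).trans (key ⟨x, B, hx⟩ B hx)

/-- The strict limit of the elements `u_{B,g}`, as an operator of left multiplication. -/
noncomputable def leftMul (h : U.IsFamily S P u) (hd : Dense (h.supported : Set A)) (g : G) :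
    A →L[ℂ] A := (h.exists_leftMul hd g).choose

variable (h : U.IsFamily S P u) (hd : Dense (h.supported : Set A))

theorem leftMul_apply (g : G) {B : U.VSet} {x : A} (hx : P B * x = x) :
    h.leftMul hd g x = u (g • B) g * x := (h.exists_leftMul hd g).choose_spec B x hx

include hd in
theorem ext_of_supported {f k : A → A} (hf : Continuous f) (hk : Continuous k)
    (H : ∀ B x, P B * x = x → f x = k x) (x : A) : f x = k x :=
  congrFun (hf.ext_on hd hk fun x ⟨B, hx⟩ => H B x hx) x

/-- Recovers `u_{B,g}` from the limit operator. For `x` with support `C`, both sides equal `u_{B ∩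
g•C, g} x`. -/
theorem proj_mul_leftMul (B : U.VSet) (g : G) (x : A) :
    P B * h.leftMul hd g x = u B g * x := by
  refine h.ext_of_supported hd (f := fun x => P B * h.leftMul hd g x)
    ((h.leftMul hd g).continuous.const_mul _) (continuous_const_mul _) (fun C x hx => ?_) x
  rw [h.leftMul_apply hd g hx, ← mul_assoc, h.proj_mul_u, ← h.u_mul_proj, mul_assoc, hx]

theorem leftMul_one (x : A) : h.leftMul hd 1 x = x := by
  refine h.ext_of_supported hd (h.leftMul hd 1).continuous continuous_id (fun C x hx => ?_) x
  rw [h.leftMul_apply hd 1 hx, one_smul, h.u_one, hx, id]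

theorem leftMul_leftMul (g k : G) (x : A) :
    h.leftMul hd g (h.leftMul hd k x) = h.leftMul hd (g * k) x := by
  refine h.ext_of_supported hd (f := fun x => h.leftMul hd g (h.leftMul hd k x))
    ((h.leftMul hd g).continuous.comp (h.leftMul hd k).continuous)
    (h.leftMul hd (g * k)).continuous (fun C x hx => ?_) x
  -- The element `u_{k•C,k} x` has support `k • C`, so the outer operator acts on it as
  -- `u_{g•(k•C),g}`.
  rw [h.leftMul_apply hd k hx, h.leftMul_apply hd (g * k) hx,
    h.leftMul_apply hd g (B := k • C), ← mul_assoc, h.u_mul, mul_smul,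
    Ultragraph.VSet.inter_eq_left subset_rfl]
  rw [← mul_assoc, h.proj_mul_u, Ultragraph.VSet.inter_eq_left subset_rfl]

/-- The compatibility of left and right operators in a double centralizer. For `z = x*` with support
`C`, `(u_{g⁻¹•C,g⁻¹} z)* = z* u_{C,g}`, and `z*` absorbs `p_C` on its right. -/
theorem star_leftMul_star_mul (g : G) (x y : A) :
    star (h.leftMul hd g⁻¹ (star x)) * y = x * h.leftMul hd g y := by
  have H := h.ext_of_supported hd
    (f := fun z => star (h.leftMul hd g⁻¹ z) * y) (k := fun z => star z * h.leftMul hd g y)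
    ((h.leftMul hd g⁻¹).continuous.star.mul_const _) (continuous_star.mul_const _)
    (fun C z hz => ?_) (star x)
  · simpa only [star_star] using H
  · have hz' : star z * P C = star z := by
      have := congrArg star hz
      rwa [star_mul, h.cuntzKrieger.star_proj] at this
    rw [h.leftMul_apply hd g⁻¹ hz, star_mul, h.u_star, inv_inv, smul_inv_smul, mul_assoc,
      ← h.proj_mul_leftMul hd, ← mul_assoc, hz']

/-- The unitary multiplier which is the strict limit of the elements `u_{B,g}`. -/
noncomputable def multiplier (g : G) : DoubleCentralizer ℂ A where
  fst := h.leftMul hd g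
  snd := (((starL ℂ : A ≃L⋆[ℂ] A) : A →L⋆[ℂ] A).comp (h.leftMul hd g⁻¹)).comp
    ((starL ℂ : A ≃L⋆[ℂ] A) : A →L⋆[ℂ] A)
  central x y := h.star_leftMul_star_mul hd g x y

theorem star_multiplier (g : G) : star (h.multiplier hd g) = h.multiplier hd g⁻¹ := by
  refine DoubleCentralizer.ext_fst fun x => ?_
  rw [DoubleCentralizer.star_fst]
  change star (star (h.leftMul hd g⁻¹ (star (star x)))) = h.leftMul hd g⁻¹ x
  rw [star_star, star_star]

theorem multiplier_mul (g k : G) :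
    h.multiplier hd (g * k) = h.multiplier hd g * h.multiplier hd k :=
  DoubleCentralizer.ext_fst fun x => (h.leftMul_leftMul hd g k x).symm

theorem multiplier_one : h.multiplier hd 1 = 1 :=
  DoubleCentralizer.ext_fst fun x => h.leftMul_one hd x

theorem coe_proj_mul_multiplier (B : U.VSet) (g : G) :
    DoubleCentralizer.coeHom (𝕜 := ℂ) (P B) * h.multiplier hd g =
      DoubleCentralizer.coeHom (𝕜 := ℂ) (u B g) :=
  DoubleCentralizer.ext_fst fun x => h.proj_mul_leftMul hd B g x

/-- A non-degenerate family gives rise to a unitary family of multipliers. -/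
theorem isUnitaryFamily_multiplier :
    U.IsUnitaryFamily (fun e => DoubleCentralizer.coeHom (𝕜 := ℂ) (S e))
      (fun B => DoubleCentralizer.coeHom (𝕜 := ℂ) (P B)) (h.multiplier hd) where
  cuntzKrieger := h.cuntzKrieger.map DoubleCentralizer.coeHom
  u_unitary g := by
    rw [Unitary.mem_iff, h.star_multiplier, ← h.multiplier_mul, ← h.multiplier_mul,
      inv_mul_cancel, mul_inv_cancel, h.multiplier_one]
    exact ⟨rfl, rfl⟩
  u_one := h.multiplier_one hd
  u_mul := h.multiplier_mul hd
  u_proj g B := by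
    rw [h.coe_proj_mul_multiplier]
    refine DoubleCentralizer.ext_fst fun x => ?_
    change h.leftMul hd g (P B * x) = u (g • B) g * x
    rw [h.leftMul_apply hd g (B := B), ← mul_assoc, h.u_mul_proj,
      Ultragraph.VSet.inter_eq_left subset_rfl]
    rw [← mul_assoc, h.cuntzKrieger.proj_mul_self]
  u_edge g e := by
    refine DoubleCentralizer.ext_fst fun x => ?_
    change h.leftMul hd g (S e * x) = S (g • e) * h.leftMul hd (U.φ g e) x
    -- As `s_e x` has support `{r(e)}`, the edge relation applies; the projection `p_{g•s(e)}` it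
    -- creates is absorbed by `s_{g•e}`.
    rw [h.leftMul_apply hd g (B := {U.r e}), ← mul_assoc,
      h.u_edge _ _ _ (by simp), mul_assoc, ← h.proj_mul_leftMul hd,
      ← mul_assoc, ← U.src_smul, h.cuntzKrieger.edge_mul_src]
    rw [← mul_assoc, h.cuntzKrieger.range_mul_edge]

end

end IsFamily

/-! ### The canonical homomorphism: injectivity and range. -/

variable (U)

/-- The non-degeneracy needed for the multipliers. A product inherits its left support from the
first factor and its right support from the last, so the induction tracks a polynomial together with
its adjoint. -/
theorem dense_supported_gen : Dense (U.isFamily_gen.supported : Set U.CStar) := by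
  have hc := U.isFamily_gen.cuntzKrieger
  have key : ∀ a : StarPoly U.Letter, a.eval U.relations.gen ∈ U.isFamily_gen.supported ∧
      star (a.eval U.relations.gen) ∈ U.isFamily_gen.supported := by
    intro a
    induction a with
    | gen y =>
      cases y with
      | s e => exact ⟨⟨_, hc.range_mul_edge e⟩, ⟨_, hc.src_mul_star_edge e⟩⟩
      | p B =>
        refine ⟨⟨B, hc.proj_mul_self B⟩, B, ?_⟩
        rw [StarPoly.eval, hc.star_proj]
        exact hc.proj_mul_self B
      | u B g =>
        have hu : ∀ (C : U.VSet) (k : G),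
            U.relations.gen (.u C k) ∈ U.isFamily_gen.supported := fun C k => by
          refine ⟨C, ?_⟩
          rw [U.isFamily_gen.proj_mul_u, Ultragraph.VSet.inter_eq_left subset_rfl]
        refine ⟨hu B g, ?_⟩
        rw [StarPoly.eval, U.isFamily_gen.u_star]
        exact hu _ _
    | zero => simp [StarPoly.eval]
    | add a b ha hb =>
      simp only [StarPoly.eval, star_add]
      exact ⟨add_mem ha.1 hb.1, add_mem ha.2 hb.2⟩
    | mul a b ha hb =>
      obtain ⟨⟨B, hB⟩, -⟩ := ha
      obtain ⟨-, ⟨C, hC⟩⟩ := hb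
      simp only [StarPoly.eval, star_mul]
      exact ⟨⟨B, by rw [← mul_assoc, hB]⟩, ⟨C, by rw [← mul_assoc, hC]⟩⟩
    | smul c a ha =>
      simp only [StarPoly.eval, star_smul]
      exact ⟨Submodule.smul_mem _ _ ha.1, Submodule.smul_mem _ _ ha.2⟩
    | adj a ha =>
      simp only [StarPoly.eval, star_star]
      exact ha.symm
  refine U.relations.dense_eval.mono ?_
  rintro _ ⟨a, rfl⟩
  exact (key a).1

/-- The canonical homomorphism from `𝒪_{G,U}` to `𝒟_{G,U}`. -/
theorem exists_hom_unitalCStar : ∃ ψ : U.CStar →⋆ₙₐ[ℂ] U.UnitalCStar,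
    ∀ x, ψ (U.relations.gen x) = letterValue U.dS U.dP U.dU x := by
  obtain ⟨ψ, ⟨h1, h2, h3⟩, -⟩ := U.existsUnique_lift U.isUnitaryFamily_gen.isFamily
  refine ⟨ψ, fun x => ?_⟩
  cases x with
  | s e => exact h1 e
  | p C => exact h2 C
  | u C g => exact h3 C g

/-- The representation of `𝒟_{G,U}` by multipliers sends `p_C u_g` back to `u_{C,g}`, so it is a
left inverse of `ψ` up to the canonical embedding. -/
theorem injective_of_gen {ψ : U.CStar →⋆ₙₐ[ℂ] U.UnitalCStar}
    (hψ : ∀ x, ψ (U.relations.gen x) = letterValue U.dS U.dP U.dU x) :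
    Function.Injective ψ := by
  obtain ⟨π, ⟨h1, h2, h3⟩, -⟩ := U.existsUnique_unital_lift
    (U.isFamily_gen.isUnitaryFamily_multiplier U.dense_supported_gen)
  have hcomp : (π : U.UnitalCStar →⋆ₙₐ[ℂ] DoubleCentralizer ℂ U.CStar).comp ψ =
      DoubleCentralizer.coeHom := by
    refine U.relations.hom_ext fun x => ?_
    change π (ψ (U.relations.gen x)) = _
    rw [hψ]
    cases x with
    | s e => exact h1 e
    | p C => exact h2 C
    | u C g =>
      rw [letterValue, map_mul, h2, h3]
      exact U.isFamily_gen.coe_proj_mul_multiplier _ C g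
  refine Function.Injective.of_comp (f := π) fun x y hxy => ?_
  exact DoubleCentralizer.coeHom_injective
    ((DFunLike.congr_fun hcomp x).symm.trans (hxy.trans (DFunLike.congr_fun hcomp y)))

theorem range_eq_tildeSpan {ψ : U.CStar →⋆ₙₐ[ℂ] U.UnitalCStar}
    (hψ : ∀ x, ψ (U.relations.gen x) = letterValue U.dS U.dP U.dU x) :
    Set.range ψ = (U.tildeSpan : Set U.UnitalCStar) := by
  have hD := U.isUnitaryFamily_gen
  have hiso := NonUnitalStarAlgHom.isometry ψ (U.injective_of_gen hψ)
  have hfun : (fun x => ψ (U.relations.gen x)) = letterValue U.dS U.dP U.dU := funext hψ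
  apply subset_antisymm
  · have hcl : IsClosed (ψ ⁻¹' (hD.closedSpan : Set U.UnitalCStar)) :=
      (Submodule.isClosed_topologicalClosure _).preimage hiso.continuous
    rintro _ ⟨y, rfl⟩
    refine U.relations.dense_eval.induction_on (p := fun y => ψ y ∈ hD.closedSpan) y hcl
      fun a => ?_
    rw [CStarRelations.eval_map, hfun]
    exact (hD.eval_mem_closedSpan a).1
  · have hS : ∀ e, U.dS e ∈ NonUnitalStarAlgHom.range ψ := fun e => ⟨_, hψ (.s e)⟩
    have hP : ∀ B, U.dP B ∈ NonUnitalStarAlgHom.range ψ := fun B => ⟨_, hψ (.p B)⟩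
    have hPu : ∀ B g, U.dP B * U.dU g ∈ NonUnitalStarAlgHom.range ψ :=
      fun B g => ⟨_, hψ (.u B g)⟩
    have hα : ∀ α : U.FinPath, α.elem U.dS U.dP ∈ NonUnitalStarAlgHom.range ψ := by
      intro α
      cases α with
      | vertex A => exact hP A
      | edges l ne hl =>
        change (l.map U.dS).prod ∈ _
        -- Every product of edges of a nonempty word lies in the range, composable or not; only the
        -- empty product `1` has to be avoided.
        clear hl
        induction l with
        | nil => exact absurd rfl ne
        | cons e l ih =>
          cases l with
          | nil => simpa using hS e
          | cons f l =>
            rw [List.map_cons, List.prod_cons]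
            exact mul_mem (hS e) (ih (by simp))
    have hclosed : IsClosed (Set.range ψ) := hiso.isClosedEmbedding.isClosed_range
    have hspan : Submodule.span ℂ (monomials U.dS U.dP U.dU) ≤
        (NonUnitalStarAlgHom.range ψ).toSubmodule := by
      refine Submodule.span_le.2 ?_
      rintro _ ⟨α, β, A, g, -, rfl⟩
      -- Grouping `p_A u_g` matters: it is the image of `u_{A,g}`, while `u_g` alone need not lie in
      -- the range.
      rw [mul_assoc (α.elem U.dS U.dP)]
      change _ ∈ NonUnitalStarAlgHom.range ψ
      exact mul_mem (mul_mem (hα α) (hPu A g)) (star_mem (hα β))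
    exact closure_minimal hspan hclosed

end SelfSimilarUltragraph

theorem mainTheorem6 {G V E : Type*} [Group G] [MulAction G V] [MulAction G E]
    (U : SelfSimilarUltragraph G V E) (hU : U.IsRegular) :
    ∃ O : NonUnitalStarSubalgebra ℂ U.UnitalCStar,
      (O : Set U.UnitalCStar) = (U.tildeSpan : Set U.UnitalCStar) ∧
        Nonempty (O ≃⋆ₐ[ℂ] U.CStar) := by
  obtain ⟨ψ, hψ⟩ := U.exists_hom_unitalCStar
  exact ⟨NonUnitalStarAlgHom.range ψ, U.range_eq_tildeSpan hψ,
    ⟨(StarAlgEquiv.ofInjective' ψ (U.injective_of_gen hψ)).symm⟩⟩
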